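/- Theorem 8.7. A *quantale* here is a complete lattice $A$ with least element $0$, greatest element $1$ and a commutative associative multiplication with unit $1$ that distributes over arbitrary joins. $K(A)$ is the set of compact elements, and $A$ is *coherent* if every element is a join of compact elements, $1\in K(A)$, and $K(A)$ is closed under multiplication. For $a\in A$ put $a^{\perp}=\bigvee\{x\in A : ax=0\}$; $a$ is *pure* if $a\vee c^{\perp}=1$ for all $c\in K(A)$ with $c\le a$. The pure elements form a frame $Vir(A)$, with joins and finite meets as in $A$. $A$ is a *$PF$-quantale* if $c^{\perp}$ is pure for every $c\in K(A)$, and a *$PP$-quantale* if $c^{\perp}$ has a complement in $A$ for every $c\in K(A)$. An element $p<1$ is *$m$-prime* if $ab\le p$ implies $a\le p$ or $b\le p$. $Spec_Z(A)$ is the set of $m$-prime elements with the topology whose open sets are $D(a)=\{p : a\not\le p\}$, $a\in A$, and $Min_Z(A)$ is its subspace of minimal $m$-prime elements, with underlying set $Min(A)$. $Spec_Z(Vir(A))$ is defined in the same way for the frame $Vir(A)$, with the meet as multiplication. The *reticulation* of a coherent quantale $A$ is the bounded distributive lattice $L(A)$, unique up to isomorphism, with a surjection $\lambda:K(A)\to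 L(A)$ such that, for all $c,d\in K(A)$, $\lambda(c\vee d)\le\lambda(c)\vee\lambda(d)$, $\lambda(cd)=\lambda(c)\wedge\lambda(d)$, and $\lambda(c)\le\lambda(d)$ iff $c^n\le d$ for some integer $n\ge 1$. For a bounded distributive lattice $L$, $Spec_{Id,Z}(L)$ is the set of prime ideals of $L$ with the topology generated by the sets $\{P : x\notin P\}$, $x\in L$, and $Min_{Id,Z}(L)$ is its subspace of minimal prime ideals. $L$ is a *Stone lattice* if for every $x\in L$ there is a complemented $e\in L$ with $\{y\in L : x\wedge y=0\}=\{y\in L : y\le e\}$. Let $A$ be a coherent $PF$-quantale. Then the following are equivalent: 1. $A$ is a $PP$-quantale; 2. the reticulation $L(A)$ is a Stone lattice; 3. the inclusion $Min_{Id,Z}(L(A))\subseteq Spec_{Id,Z}(L(A))$ has a continuous retraction; 4. the inclusion $Min_Z(A)\subseteq Spec_Z(A)$ has a continuous retraction; 5. for every $c\in K(A)$, $Min(A)\cap D(c)$ is (as a set of elements of $A$) an open subset of $Spec_Z(Vir(A))$; 6. $Min_Z(A)$ is a compact space. -/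

import Mathlib

namespace PPQuantale

/-! ### Quantales

A quantale is Mathlib's `IsQuantale`. All quantales are commutative and integral. -/

/-- A commutative integral quantale: the top element is the unit of the multiplication. -/
class IsIntegralQuantale (A : Type*) [CommMonoid A] [CompleteLattice A] : Prop
    extends IsQuantale A where
  one_eq_top : (1 : A) = ⊤

/-- A coherent quantale: every element is a join of compact elements, the top element is
compact, and the compact elements are closed under multiplication. -/
class IsCoherentQuantale (A : Type*) [CommMonoid A] [CompleteLattice A] : Prop
    extends IsIntegralQuantale A, IsCompactlyGenerated A where
  isCompactElement_top : IsCompactElement (⊤ : A)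
  isCompactElement_mul : ∀ c d : A, IsCompactElement c → IsCompactElement d →
    IsCompactElement (c * d)

section Basic

variable {A : Type*} [CommMonoid A] [CompleteLattice A]

theorem mul_le_left_of_integral [IsIntegralQuantale A] (a b : A) : a * b ≤ a := by
  calc a * b ≤ a * 1 := mul_le_mul_right (IsIntegralQuantale.one_eq_top (A := A) ▸ le_top) a
    _ = a := mul_one a

theorem mul_le_right_of_integral [IsIntegralQuantale A] (a b : A) : a * b ≤ b := by
  rw [mul_comm]; exact mul_le_left_of_integral b a

/-- The annihilator `a^⊥`, the join of all `x` with `a * x = 0`. -/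
def perp (a : A) : A := sSup {x | a * x = ⊥}

theorem le_perp_iff [IsQuantale A] {a x : A} : x ≤ perp a ↔ a * x = ⊥ := by
  constructor
  · intro h
    refine le_bot_iff.1 ((mul_le_mul_right h a).trans ?_)
    rw [perp, mul_sSup_distrib]
    exact iSup₂_le fun y hy => le_of_eq hy
  · exact fun h => le_sSup h

/-- Pure elements. -/
def IsPure (a : A) : Prop := ∀ c : A, IsCompactElement c → c ≤ a → a ⊔ perp c = ⊤

/-- A `PF`-quantale: the annihilator of every compact element is pure. -/
def IsPF (A : Type*) [CommMonoid A] [CompleteLattice A] : Prop :=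
  ∀ c : A, IsCompactElement c → IsPure (perp c)

/-- A `PP`-quantale: the annihilator of every compact element is complemented. -/
def IsPP (A : Type*) [CommMonoid A] [CompleteLattice A] : Prop :=
  ∀ c : A, IsCompactElement c → IsComplemented (perp c)

/-! ### The spectrum -/

/-- `m`-prime elements. -/
def IsMPrime (p : A) : Prop := p < ⊤ ∧ ∀ a b : A, a * b ≤ p → a ≤ p ∨ b ≤ p

end Basic

/-- The set `Spec(A)` of `m`-prime elements. -/
@[ext]
structure MSpec (A : Type*) [CommMonoid A] [CompleteLattice A] where
  val : A
  isMPrime : IsMPrime val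

namespace MSpec

variable {A : Type*} [CommMonoid A] [CompleteLattice A]

instance : PartialOrder (MSpec A) := PartialOrder.lift MSpec.val fun _ _ => MSpec.ext

/-- `D(a)`, the set of the `m`-primes that are not above `a`. -/
def D (a : A) : Set (MSpec A) := {p | ¬ a ≤ p.val}

/-- The space `Spec_Z(A)`: the open sets are exactly the sets `D(a)`, that is, the closed sets
are exactly the sets `V(a)` of the `m`-primes above `a`. -/
instance [IsIntegralQuantale A] : TopologicalSpace (MSpec A) where
  IsOpen U := ∃ a : A, U = D a
  isOpen_univ := ⟨⊤, by
    ext p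
    simpa [D] using p.isMPrime.1.ne⟩
  isOpen_inter := by
    rintro _ _ ⟨a, rfl⟩ ⟨b, rfl⟩
    refine ⟨a * b, Set.ext fun p => ⟨fun h hab => ?_, fun h => ⟨fun ha => h ?_, fun hb => h ?_⟩⟩⟩
    · exact (p.isMPrime.2 a b hab).elim h.1 h.2
    · exact (mul_le_left_of_integral a b).trans ha
    · exact (mul_le_right_of_integral a b).trans hb
  isOpen_sUnion := by
    intro S hS
    refine ⟨sSup {a | D a ∈ S}, Set.ext fun p => ?_⟩
    simp only [Set.mem_sUnion, D, Set.mem_ofPred_eq, sSup_le_iff, not_forall]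
    constructor
    · rintro ⟨U, hU, hp⟩
      obtain ⟨a, rfl⟩ := hS U hU
      exact ⟨a, hU, hp⟩
    · rintro ⟨a, ha, hp⟩
      exact ⟨_, ha, hp⟩

/-- The set `Min(A)` of minimal `m`-primes; as a subspace of `MSpec A` it is `Min_Z(A)`. -/
def minimals (A : Type*) [CommMonoid A] [CompleteLattice A] : Set (MSpec A) := {p | IsMin p}

end MSpec

/-! ### The frame of pure elements -/

/-- The set `Vir(A)` of pure elements. -/
@[ext]
structure Vir (A : Type*) [CommMonoid A] [CompleteLattice A] where
  val : A
  isPure : IsPure val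

section Vir

variable {A : Type*} [CommMonoid A] [CompleteLattice A]

theorem sup_mul_eq_top [IsIntegralQuantale A] {a b x : A} (ha : a ⊔ x = ⊤) (hb : b ⊔ x = ⊤) :
    a * b ⊔ x = ⊤ := by
  have h : (a ⊔ x) * (b ⊔ x) = ⊤ := by
    rw [ha, hb, ← IsIntegralQuantale.one_eq_top, one_mul]
  refine top_le_iff.1 (h ▸ ?_)
  rw [Quantale.sup_mul_distrib, Quantale.mul_sup_distrib]
  exact sup_le (sup_le le_sup_left ((mul_le_right_of_integral a x).trans le_sup_right))
    ((mul_le_left_of_integral x _).trans le_sup_right)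

theorem perp_anti [IsQuantale A] {a b : A} (h : a ≤ b) : perp b ≤ perp a := by
  rw [le_perp_iff]
  exact le_bot_iff.1 ((mul_le_mul_left h _).trans (le_perp_iff.1 le_rfl).le)

theorem IsPure.top [IsIntegralQuantale A] : IsPure (⊤ : A) := fun _ _ _ => top_sup_eq _

theorem IsPure.mul [IsIntegralQuantale A] {a b : A} (ha : IsPure a) (hb : IsPure b) :
    IsPure (a * b) := fun c hc h =>
  sup_mul_eq_top (ha c hc (h.trans (mul_le_left_of_integral a b)))
    (hb c hc (h.trans (mul_le_right_of_integral a b)))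

theorem isPure_sSup [IsCoherentQuantale A] {S : Set A} (hS : ∀ a ∈ S, IsPure a) :
    IsPure (sSup S) := by
  classical
  intro c hc hcS
  have h1 : sSup S ≤ sSup {d : A | IsCompactElement d ∧ ∃ a ∈ S, d ≤ a} := by
    refine sSup_le fun a ha => ?_
    rw [← sSup_compact_le_eq a]
    exact sSup_le_sSup fun d hd => ⟨hd.1, a, ha, hd.2⟩
  obtain ⟨t, ht, hct⟩ :=
    (CompleteLattice.isCompactElement_iff_exists_le_sSup_of_le_sSup A c).1 hc _ (hcS.trans h1)
  have key : ∀ t : Finset A, (↑t ⊆ {d : A | IsCompactElement d ∧ ∃ a ∈ S, d ≤ a}) →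
      sSup S ⊔ perp (t.sup id) = ⊤ := by
    intro t
    induction t using Finset.induction_on with
    | empty =>
      intro _
      refine top_le_iff.1 (le_trans ?_ le_sup_right)
      rw [Finset.sup_empty, le_perp_iff, Quantale.bot_mul]
    | insert d t _ ih =>
      intro h
      rw [Finset.coe_insert, Set.insert_subset_iff] at h
      obtain ⟨⟨hd, a, ha, hda⟩, h⟩ := h
      have hd' : perp d ⊔ sSup S = ⊤ :=
        top_le_iff.1 ((hS a ha d hd hda).ge.trans
          (sup_le ((le_sSup ha).trans le_sup_right) le_sup_left))
      have h2 := sup_mul_eq_top hd' ((sup_comm _ _).trans (ih h))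
      refine top_le_iff.1 (h2.ge.trans (sup_le (le_trans ?_ le_sup_right) le_sup_left))
      rw [le_perp_iff, Finset.sup_insert, Quantale.sup_mul_distrib, id]
      refine le_bot_iff.1 (sup_le ?_ ?_)
      · exact (mul_le_mul_right (mul_le_left_of_integral _ _) d).trans
          (le_perp_iff.1 le_rfl).le
      · exact (mul_le_mul_right (mul_le_right_of_integral _ _) _).trans
          (le_perp_iff.1 le_rfl).le
  exact top_le_iff.1 ((key t ht).ge.trans (sup_le_sup_left (perp_anti hct) _))

/-- A pure element absorbs the elements below it. -/
theorem IsPure.inf_le_mul [IsCoherentQuantale A] {a b : A} (ha : IsPure a) :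
    b ⊓ a ≤ b * a := by
  refine le_iff_compact_le_imp.2 fun c hc h => ?_
  calc c = c * (a ⊔ perp c) := by
        rw [ha c hc (h.trans inf_le_right), ← IsIntegralQuantale.one_eq_top, mul_one]
    _ = c * a := by rw [Quantale.mul_sup_distrib, le_perp_iff.1 le_rfl, sup_bot_eq]
    _ ≤ b * a := mul_le_mul_left (h.trans inf_le_left) a

namespace Vir

instance : PartialOrder (Vir A) := PartialOrder.lift Vir.val fun _ _ => Vir.ext

instance [IsCoherentQuantale A] : SupSet (Vir A) where
  sSup S := ⟨sSup (Vir.val '' S), isPure_sSup (by rintro _ ⟨a, _, rfl⟩; exact a.2)⟩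

/-- Joins of pure elements are computed in `A`. -/
instance [IsCoherentQuantale A] : CompleteLattice (Vir A) :=
  completeLatticeOfSup (Vir A) fun S =>
    ⟨fun a ha => le_sSup (a := a.val) ⟨a, ha, rfl⟩,
      fun b hb => sSup_le (a := b.val) (by rintro _ ⟨a, ha, rfl⟩; exact hb ha)⟩

/-- The multiplication of pure elements is that of `A`. -/
instance [IsCoherentQuantale A] : CommMonoid (Vir A) where
  mul a b := ⟨a.val * b.val, a.isPure.mul b.isPure⟩
  one := ⟨1, IsIntegralQuantale.one_eq_top (A := A) ▸ IsPure.top⟩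
  mul_assoc a b c := Vir.ext (mul_assoc a.val b.val c.val)
  one_mul a := Vir.ext (one_mul a.val)
  mul_one a := Vir.ext (mul_one a.val)
  mul_comm a b := Vir.ext (mul_comm a.val b.val)

theorem val_sSup [IsCoherentQuantale A] (S : Set (Vir A)) :
    (sSup S).1 = sSup (Vir.val '' S) := rfl

theorem val_mul [IsCoherentQuantale A] (a b : Vir A) : (a * b).1 = a.val * b.val := rfl

/-- The multiplication of `Vir A` is the meet: `Vir A` is a frame. -/
theorem mul_eq_inf [IsCoherentQuantale A] (a b : Vir A) : a * b = a ⊓ b := by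
  refine le_antisymm (le_inf ?_ ?_) ?_
  · exact mul_le_left_of_integral a.val b.val
  · exact mul_le_right_of_integral a.val b.val
  · exact (le_inf (a := a.val) (b := b.val) (show (a ⊓ b).1 ≤ a.val from inf_le_left (a := a))
      (show (a ⊓ b).1 ≤ b.val from inf_le_right (a := a))).trans b.isPure.inf_le_mul

instance [IsCoherentQuantale A] : IsIntegralQuantale (Vir A) where
  one_eq_top := by
    refine top_le_iff.1 ?_
    change (⊤ : Vir A).1 ≤ (1 : A)
    exact IsIntegralQuantale.one_eq_top (A := A) ▸ le_top
  mul_sSup_distrib a S := by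
    rw [← sSup_image]
    refine Vir.ext ?_
    rw [val_mul, val_sSup, val_sSup, mul_sSup_distrib, ← sSup_image, Set.image_image,
      Set.image_image]
    rfl
  sSup_mul_distrib S a := by
    rw [← sSup_image]
    refine Vir.ext ?_
    rw [val_mul, val_sSup, val_sSup, sSup_mul_distrib, ← sSup_image, Set.image_image,
      Set.image_image]
    rfl

end Vir

end Vir

/-! ### The reticulation -/

/-- The set `K(A)` of compact elements. -/
structure CompactElt (A : Type*) [CompleteLattice A] where
  val : A
  isCompact : IsCompactElement val

theorem isCompactElement_sup {A : Type*} [CompleteLattice A] {c d : A} (hc : IsCompactElement c) (hd : IsCompactElement d) :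
    IsCompactElement (c ⊔ d) := by
  classical
  have := CompleteLattice.isCompactElement_finsetSup (f := id) ({c, d} : Finset A)
    (by intro x hx; simp only [Finset.mem_insert, Finset.mem_singleton] at hx
        rcases hx with rfl | rfl <;> assumption)
  simpa using this

theorem isCompactElement_bot {A : Type*} [CompleteLattice A] : IsCompactElement (⊥ : A) := by
  simpa using CompleteLattice.isCompactElement_finsetSup (f := id) (∅ : Finset A) (by simp)

section Reticulation

variable {A : Type*} [CommMonoid A] [CompleteLattice A]

/-- Some positive power of `c` is below `d`. -/
def PowLE (c d : A) : Prop := ∃ n : ℕ, 1 ≤ n ∧ c ^ n ≤ d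

theorem PowLE.of_le {c d : A} (h : c ≤ d) : PowLE c d := ⟨1, le_rfl, by rwa [pow_one]⟩

theorem PowLE.trans [IsQuantale A] {c d e : A} : PowLE c d → PowLE d e → PowLE c e := by
  rintro ⟨n, hn, h⟩ ⟨m, hm, h'⟩
  exact ⟨n * m, Nat.mul_pos hn hm, by
    rw [pow_mul]
    exact (pow_le_pow_left' h m).trans h'⟩

theorem PowLE.mul [IsIntegralQuantale A] {c d e : A} :
    PowLE c d → PowLE c e → PowLE c (d * e) := by
  rintro ⟨n, hn, h⟩ ⟨m, hm, h'⟩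
  exact ⟨n + m, by omega, by
    rw [pow_add]
    exact mul_le_mul' h h'⟩

theorem sup_pow_le [IsIntegralQuantale A] (c d : A) (n m : ℕ) :
    (c ⊔ d) ^ (n + m) ≤ c ^ n ⊔ d ^ m := by
  induction n generalizing m with
  | zero =>
    refine le_trans ?_ le_sup_left
    rw [pow_zero, IsIntegralQuantale.one_eq_top (A := A)]
    exact le_top
  | succ n ih =>
    induction m with
    | zero =>
      refine le_trans ?_ le_sup_right
      rw [pow_zero, IsIntegralQuantale.one_eq_top (A := A)]
      exact le_top
    | succ m ihm =>
      have e : (c ⊔ d) ^ (n + 1 + (m + 1)) =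
          c * (c ⊔ d) ^ (n + (m + 1)) ⊔ d * (c ⊔ d) ^ (n + 1 + m) := by
        rw [show n + 1 + (m + 1) = n + m + 1 + 1 by omega, pow_succ', Quantale.sup_mul_distrib,
          show n + (m + 1) = n + m + 1 by omega, show n + 1 + m = n + m + 1 by omega]
      rw [e]
      refine sup_le ((mul_le_mul_right (ih (m + 1)) c).trans ?_)
        ((mul_le_mul_right ihm d).trans ?_)
      · rw [Quantale.mul_sup_distrib, ← pow_succ']
        exact sup_le_sup_left (mul_le_right_of_integral _ _) _
      · rw [Quantale.mul_sup_distrib, ← pow_succ']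
        exact sup_le_sup_right (mul_le_right_of_integral _ _) _

theorem PowLE.sup [IsIntegralQuantale A] {c d e : A} :
    PowLE c e → PowLE d e → PowLE (c ⊔ d) e := by
  rintro ⟨n, hn, h⟩ ⟨m, hm, h'⟩
  exact ⟨n + m, by omega, (sup_pow_le c d n m).trans (sup_le h h')⟩

/-- Two compact elements are identified if each has a positive power below the other. -/
def reticulationSetoid (A : Type*) [CommMonoid A] [CompleteLattice A] [IsQuantale A] :
    Setoid (CompactElt A) where
  r c d := PowLE c.val d.val ∧ PowLE d.val c.val
  iseqv := ⟨fun _ => ⟨.of_le le_rfl, .of_le le_rfl⟩, fun h => ⟨h.2, h.1⟩,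
    fun h h' => ⟨h.1.trans h'.1, h'.2.trans h.2⟩⟩

/-- The reticulation `L(A)`. -/
def Reticulation (A : Type*) [CommMonoid A] [CompleteLattice A] [IsQuantale A] : Type _ :=
  Quotient (reticulationSetoid A)

namespace Reticulation

/-- The canonical map `λ_A : K(A) → L(A)`. -/
def mk [IsQuantale A] (c : CompactElt A) : Reticulation A :=
  Quotient.mk (reticulationSetoid A) c

theorem mk_surjective [IsQuantale A] : Function.Surjective (mk : CompactElt A → _) :=
  Quotient.mk_surjective

instance [IsQuantale A] : PartialOrder (Reticulation A) where
  le x y := Quotient.liftOn₂ x y (fun c d => PowLE c.val d.val) fun _ _ _ _ h h' =>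
    propext ⟨fun k => (h.2.trans k).trans h'.1, fun k => (h.1.trans k).trans h'.2⟩
  le_refl x := Quotient.inductionOn x fun _ => PowLE.of_le le_rfl
  le_trans x y z := Quotient.inductionOn₃ x y z fun _ _ _ h h' => PowLE.trans h h'
  le_antisymm x y := Quotient.inductionOn₂ x y fun _ _ h h' => Quotient.sound ⟨h, h'⟩

theorem mk_le_mk [IsQuantale A] {c d : CompactElt A} : mk c ≤ mk d ↔ PowLE c.val d.val := Iff.rfl

instance [IsCoherentQuantale A] : Lattice (Reticulation A) where
  sup := Quotient.map₂ (fun c d => ⟨c.val ⊔ d.val, isCompactElement_sup c.isCompact d.isCompact⟩)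
    fun _ _ h _ _ h' =>
      ⟨.sup (h.1.trans (.of_le le_sup_left)) (h'.1.trans (.of_le le_sup_right)),
        .sup (h.2.trans (.of_le le_sup_left)) (h'.2.trans (.of_le le_sup_right))⟩
  inf := Quotient.map₂
    (fun c d => ⟨c.val * d.val, IsCoherentQuantale.isCompactElement_mul _ _ c.isCompact d.isCompact⟩)
    fun _ _ h _ _ h' =>
      ⟨.mul (.trans (.of_le (mul_le_left_of_integral _ _)) h.1)
          (.trans (.of_le (mul_le_right_of_integral _ _)) h'.1),
        .mul (.trans (.of_le (mul_le_left_of_integral _ _)) h.2)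
          (.trans (.of_le (mul_le_right_of_integral _ _)) h'.2)⟩
  le_sup_left x y := Quotient.inductionOn₂ x y fun _ _ => PowLE.of_le le_sup_left
  le_sup_right x y := Quotient.inductionOn₂ x y fun _ _ => PowLE.of_le le_sup_right
  sup_le x y z := Quotient.inductionOn₃ x y z fun _ _ _ h h' => PowLE.sup h h'
  inf_le_left x y := Quotient.inductionOn₂ x y fun _ _ =>
    PowLE.of_le (mul_le_left_of_integral _ _)
  inf_le_right x y := Quotient.inductionOn₂ x y fun _ _ =>
    PowLE.of_le (mul_le_right_of_integral _ _)
  le_inf x y z := Quotient.inductionOn₃ x y z fun _ _ _ h h' => PowLE.mul h h'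

theorem mk_sup [IsCoherentQuantale A] (c d : CompactElt A) :
    mk ⟨c.val ⊔ d.val, isCompactElement_sup c.isCompact d.isCompact⟩ = mk c ⊔ mk d := rfl

theorem mk_mul [IsCoherentQuantale A] (c d : CompactElt A) :
    mk ⟨c.val * d.val, IsCoherentQuantale.isCompactElement_mul _ _ c.isCompact d.isCompact⟩ = mk c ⊓ mk d := rfl

instance [IsCoherentQuantale A] : DistribLattice (Reticulation A) where
  le_sup_inf x y z := Quotient.inductionOn₃ x y z fun a b c => PowLE.of_le <| by
    change (a.val ⊔ b.val) * (a.val ⊔ c.val) ≤ a.val ⊔ b.val * c.val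
    rw [Quantale.sup_mul_distrib, Quantale.mul_sup_distrib (x := b.val)]
    exact sup_le ((mul_le_left_of_integral _ _).trans le_sup_left)
      (sup_le ((mul_le_right_of_integral _ _).trans le_sup_left) le_sup_right)

instance [IsCoherentQuantale A] : BoundedOrder (Reticulation A) where
  top := mk ⟨⊤, IsCoherentQuantale.isCompactElement_top⟩
  bot := mk ⟨⊥, isCompactElement_bot⟩
  le_top x := Quotient.inductionOn x fun _ => PowLE.of_le le_top
  bot_le x := Quotient.inductionOn x fun _ => PowLE.of_le bot_le

end Reticulation

/-- The axioms of a reticulation `(L, λ)` of `A`. By surjectivity and the third clause they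
determine `(L, λ)` up to a unique isomorphism. -/
structure IsReticulation [IsCoherentQuantale A] {L : Type*} [DistribLattice L] [BoundedOrder L]
    (lam : CompactElt A → L) : Prop where
  surjective : Function.Surjective lam
  map_sup_le : ∀ c d : CompactElt A,
    lam ⟨c.val ⊔ d.val, isCompactElement_sup c.isCompact d.isCompact⟩ ≤ lam c ⊔ lam d
  map_mul : ∀ c d : CompactElt A,
    lam ⟨c.val * d.val, IsCoherentQuantale.isCompactElement_mul _ _ c.isCompact d.isCompact⟩ = lam c ⊓ lam d
  map_le_map_iff : ∀ c d : CompactElt A, lam c ≤ lam d ↔ ∃ n : ℕ, 1 ≤ n ∧ c.val ^ n ≤ d.val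

theorem Reticulation.isReticulation [IsCoherentQuantale A] :
    IsReticulation (mk : CompactElt A → Reticulation A) where
  surjective := mk_surjective
  map_sup_le c d := (mk_sup c d).le
  map_mul := mk_mul
  map_le_map_iff _ _ := mk_le_mk

end Reticulation

/-! ### Bounded distributive lattices -/

/-- A Stone lattice: the annihilator of every element is the principal ideal generated by a
complemented element. -/
def IsStoneLattice (L : Type*) [DistribLattice L] [BoundedOrder L] : Prop :=
  ∀ x : L, ∃ e : L, IsComplemented e ∧ {y : L | x ⊓ y = ⊥} = Set.Iic e

/-- The set `Spec_Id(L)` of prime ideals. -/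
@[ext]
structure IdSpec (L : Type*) [DistribLattice L] [BoundedOrder L] where
  val : Order.Ideal L
  isPrime : val.IsPrime

namespace IdSpec

variable {L : Type*} [DistribLattice L] [BoundedOrder L]

instance : PartialOrder (IdSpec L) := PartialOrder.lift IdSpec.val fun _ _ => IdSpec.ext

/-- The space `Spec_{Id,Z}(L)`: the topology generated by the sets `{P | x ∉ P}`, which form
a basis because `L` is a lattice. -/
instance : TopologicalSpace (IdSpec L) :=
  TopologicalSpace.generateFrom (Set.range fun x : L => {P : IdSpec L | x ∉ P.val})

/-- The set `Min_Id(L)` of minimal prime ideals; as a subspace of `IdSpec L` it is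
`Min_{Id,Z}(L)`. -/
def minimals (L : Type*) [DistribLattice L] [BoundedOrder L] : Set (IdSpec L) := {P | IsMin P}

end IdSpec

/-- The inclusion of the subspace `S` into `X` has a continuous retraction. -/
def HasContinuousRetraction {X : Type*} [TopologicalSpace X] (S : Set X) : Prop :=
  ∃ r : X → S, Continuous r ∧ ∀ p : S, r p = p

end PPQuantale

open PPQuantale

namespace PPQuantale

/-! ### Products, complements and compactness -/

section Quantale

variable {A : Type*} [CommMonoid A] [CompleteLattice A]

/-! The `PF` condition says that `cd = 0` forces `c^⊥ ∨ d^⊥ = 1` for compact `c`, `d`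
(`IsPF.perp_sup_perp`). It excludes nonzero nilpotent compact elements, so the minimal `m`-primes
meet in `0`. It also makes the join of the compact `c` with `c^⊥ ≰ p` an `m`-prime
(`IsPF.isMPrime_purePart`), and this is the least `m`-prime below `p`. Hence a minimal `m`-prime
contains exactly one of `c` and `c^⊥`, and the minimal `m`-primes are exactly the pure ones.

If `e` is a complement of `c^⊥`, then `D(c)` pulls back to `D(e)` along the map sending `p` to the
minimal `m`-prime below it, which is therefore a continuous retraction. A retract of the compact
space `Spec_Z(A)` is compact. Conversely, compactness of `Min_Z(A)` yields one compact `d ≤ c^⊥`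
such that no minimal `m`-prime contains both `c` and `d`, and then `d^⊥` is a complement of `c^⊥`.

An open set of `Spec_Z(Vir(A))` is `D(a)` with `a` pure; condition 5 says that `a` and `c` lie below
the same minimal `m`-primes, and such an `a` is a complement of `c^⊥`. The Stone condition transfers
because `λ(c) = 0` only for `c = 0`, and the retractions transfer along the homeomorphism of the
spectra of `A` and `L(A)`. -/

theorem mul_perp_eq_bot [IsQuantale A] (a : A) : a * perp a = ⊥ := le_perp_iff.1 le_rfl

theorem eq_mul_of_sup_eq_top [IsIntegralQuantale A] {a b c : A} (h : a ⊔ b = ⊤)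
    (hb : c * b = ⊥) : c = c * a := by
  calc c = c * (a ⊔ b) := by rw [h, ← IsIntegralQuantale.one_eq_top, mul_one]
    _ = c * a := by rw [Quantale.mul_sup_distrib, hb, sup_bot_eq]

theorem le_of_sup_eq_top_of_mul_eq_bot [IsIntegralQuantale A] {a b c : A} (h : a ⊔ b = ⊤)
    (hb : c * b = ⊥) : c ≤ a :=
  (eq_mul_of_sup_eq_top h hb).le.trans (mul_le_right_of_integral c a)

/-- The meet is killed by `b`, since `(a ⊓ b)b ≤ ab = 0`; as `a ∨ b = 1`, this gives `a ⊓ b = (a ⊓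
b)a ≤ ba = 0`. Complements can thus be tested with products. -/
theorem isCompl_of_mul_eq_bot [IsIntegralQuantale A] {a b : A} (h : a ⊔ b = ⊤)
    (hab : a * b = ⊥) : IsCompl a b := by
  refine ⟨disjoint_iff.2 ?_, codisjoint_iff.2 h⟩
  have h1 : (a ⊓ b) * b = ⊥ := le_bot_iff.1 ((mul_le_mul_left inf_le_left b).trans hab.le)
  rw [eq_mul_of_sup_eq_top h h1]
  refine le_bot_iff.1 ((mul_le_mul_left inf_le_right a).trans ?_)
  rw [mul_comm, hab]

theorem mul_eq_bot_of_isCompl [IsIntegralQuantale A] {a b : A} (h : IsCompl a b) : a * b = ⊥ :=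
  le_bot_iff.1 ((le_inf (mul_le_left_of_integral a b) (mul_le_right_of_integral a b)).trans
    h.inf_eq_bot.le)

theorem isPure_of_isCompl [IsIntegralQuantale A] {a b : A} (h : IsCompl a b) : IsPure a := by
  intro c _ hca
  refine top_le_iff.1 (h.sup_eq_top.ge.trans (sup_le_sup_left (le_perp_iff.2 ?_) a))
  exact le_bot_iff.1 ((mul_le_mul_left hca b).trans (mul_eq_bot_of_isCompl h).le)

variable [IsCoherentQuantale A]

theorem exists_isCompactElement_of_not_le {a b : A} (h : ¬ a ≤ b) :
    ∃ c : A, IsCompactElement c ∧ c ≤ a ∧ ¬ c ≤ b := by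
  by_contra! H
  exact h (le_iff_compact_le_imp.2 H)

/-- Joining a directed family with the complement `b` turns a cover of `a` into a cover of the
compact element `1`; multiplying by `a` afterwards removes `b`. -/
theorem isCompactElement_of_isCompl {a b : A} (h : IsCompl a b) : IsCompactElement a := by
  intro s u hs hd hu hau
  have hb : IsLUB ((fun x => x ⊔ b) '' s) (u ⊔ b) := by
    refine ⟨?_, fun y hy => sup_le (hu.2 fun x hx => ?_) ?_⟩
    · rintro _ ⟨x, hx, rfl⟩
      exact sup_le_sup_right (hu.1 hx) b
    · exact le_sup_left.trans (hy ⟨x, hx, rfl⟩)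
    · obtain ⟨x, hx⟩ := hs
      exact le_sup_right.trans (hy ⟨x, hx, rfl⟩)
  obtain ⟨_, ⟨x, hx, rfl⟩, hxb⟩ := IsCoherentQuantale.isCompactElement_top (A := A) _ _
    (hs.image fun x => x ⊔ b)
    (by
      rintro _ ⟨x, hx, rfl⟩ _ ⟨y, hy, rfl⟩
      obtain ⟨z, hz, hxz, hyz⟩ := hd x hx y hy
      exact ⟨_, ⟨z, hz, rfl⟩, sup_le_sup_right hxz b, sup_le_sup_right hyz b⟩)
    hb (h.sup_eq_top.ge.trans (sup_le_sup_right hau b))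
  exact ⟨x, hx, le_of_sup_eq_top_of_mul_eq_bot (top_le_iff.1 hxb) (mul_eq_bot_of_isCompl h)⟩

theorem exists_le_of_le_sSup_of_isCompactElement {A : Type*} [CompleteLattice A] {S : Set A} (hbot : ⊥ ∈ S)
    (hsup : ∀ a ∈ S, ∀ b ∈ S, a ⊔ b ∈ S) {c : A} (hc : IsCompactElement c) (h : c ≤ sSup S) :
    ∃ d ∈ S, c ≤ d :=
  hc S (sSup S) ⟨⊥, hbot⟩ (fun a ha b hb => ⟨a ⊔ b, hsup a ha b hb, le_sup_left, le_sup_right⟩)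
    (isLUB_sSup S) h

theorem isCompactElement_pow {c : A} (hc : IsCompactElement c) (n : ℕ) :
    IsCompactElement (c ^ n) := by
  induction n with
  | zero =>
    rw [pow_zero, IsIntegralQuantale.one_eq_top]
    exact IsCoherentQuantale.isCompactElement_top
  | succ n ih =>
    rw [pow_succ]
    exact IsCoherentQuantale.isCompactElement_mul _ _ ih hc

/-! ### Existence of `m`-prime elements -/

theorem isMPrime_of_isCompactElement {p : A} (hp : p < ⊤)
    (h : ∀ c d : A, IsCompactElement c → IsCompactElement d → c * d ≤ p → c ≤ p ∨ d ≤ p) :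
    IsMPrime p := by
  refine ⟨hp, fun a b hab => ?_⟩
  by_contra! H
  obtain ⟨c, hc, hca, hcp⟩ := exists_isCompactElement_of_not_le H.1
  obtain ⟨d, hd, hdb, hdp⟩ := exists_isCompactElement_of_not_le H.2
  exact (h c d hc hd ((mul_le_mul' hca hdb).trans hab)).elim hcp hdp

/-- Zorn's lemma gives a maximal element above `a` among those containing no power of `c`; chains
have bounds because powers of `c` are compact. If `b` and `d` are not below it, its joins with them
contain `c ^ n` and `c ^ m`, whose product would lie below it if `bd` did. -/
theorem exists_isMPrime {c a : A} (hc : IsCompactElement c) (h : ∀ n : ℕ, ¬ c ^ n ≤ a) :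
    ∃ p : A, IsMPrime p ∧ a ≤ p ∧ ¬ c ≤ p := by
  obtain ⟨p, hap, hp⟩ := zorn_le_nonempty₀ {x : A | ∀ n : ℕ, ¬ c ^ n ≤ x}
    (by
      intro s hs hchain y hy
      refine ⟨sSup s, fun n hn => ?_, fun z hz => le_sSup hz⟩
      obtain ⟨x, hx, hnx⟩ := isCompactElement_pow hc n s _ ⟨y, hy⟩ hchain.directedOn
        (isLUB_sSup s) hn
      exact hs hx n hnx) a h
  have key : ∀ b : A, ¬ b ≤ p → ∃ n : ℕ, c ^ n ≤ p ⊔ b := by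
    intro b hb
    by_contra! H
    exact hb (le_sup_right.trans (hp.2 H le_sup_left))
  refine ⟨p, ⟨lt_of_le_of_ne le_top ?_, fun b d hbd => ?_⟩, hap, fun hcp => ?_⟩
  · rintro rfl
    exact hp.1 0 le_top
  · by_contra! H
    obtain ⟨n, hn⟩ := key b H.1
    obtain ⟨m, hm⟩ := key d H.2
    refine hp.1 (n + m) ?_
    rw [pow_add]
    refine (mul_le_mul' hn hm).trans ?_
    rw [Quantale.sup_mul_distrib, Quantale.mul_sup_distrib (x := b)]
    exact sup_le (mul_le_left_of_integral _ _) (sup_le (mul_le_right_of_integral _ _) hbd)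
  · exact hp.1 1 (by rwa [pow_one])

theorem exists_isMPrime_ge {a : A} (h : a ≠ ⊤) : ∃ p : A, IsMPrime p ∧ a ≤ p := by
  obtain ⟨p, hp, hap, -⟩ := exists_isMPrime (a := a)
    IsCoherentQuantale.isCompactElement_top fun n hn => h (by
      rwa [← IsIntegralQuantale.one_eq_top, one_pow, IsIntegralQuantale.one_eq_top,
        top_le_iff] at hn)
  exact ⟨p, hp, hap⟩

theorem IsMPrime.le_of_pow_le {p c : A} (hp : IsMPrime p) {n : ℕ} (h : c ^ n ≤ p) : c ≤ p := by
  induction n with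
  | zero =>
    rw [pow_zero, IsIntegralQuantale.one_eq_top] at h
    exact le_top.trans h
  | succ n ih =>
    rw [pow_succ] at h
    exact (hp.2 _ _ h).elim ih id

theorem IsMPrime.le_of_not_perp_le {p a : A} (hp : IsMPrime p) (h : ¬ perp a ≤ p) : a ≤ p :=
  (hp.2 a (perp a) ((mul_perp_eq_bot a).le.trans bot_le)).resolve_right h

/-! ### The pure part of an `m`-prime element -/

/-- The join of the compact elements whose annihilator is not below `p`. -/
def purePart (p : A) : A := sSup {c | IsCompactElement c ∧ ¬ perp c ≤ p}

/-- The compact elements being joined are closed under finite joins, because `a^⊥ b^⊥ ≤ (a ∨ b)^⊥`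
and `p` is `m`-prime. A compact element below their join is therefore below one of them. -/
theorem IsMPrime.le_purePart_iff {p c : A} (hp : IsMPrime p) (hc : IsCompactElement c) :
    c ≤ purePart p ↔ ¬ perp c ≤ p := by
  refine ⟨fun h hcp => ?_, fun h => le_sSup ⟨hc, h⟩⟩
  obtain ⟨d, hd, hcd⟩ := exists_le_of_le_sSup_of_isCompactElement
    (S := {c | IsCompactElement c ∧ ¬ perp c ≤ p})
    ⟨isCompactElement_bot, fun h => hp.1.not_ge (le_trans
      (le_perp_iff.2 (Quantale.bot_mul)) h)⟩
    (by
      rintro a ⟨ha, hap⟩ b ⟨hb, hbp⟩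
      refine ⟨isCompactElement_sup ha hb, fun h => ?_⟩
      refine (hp.2 (perp a) (perp b) (le_trans (le_perp_iff.2 ?_) h)).elim hap hbp
      rw [Quantale.sup_mul_distrib, ← mul_assoc, mul_perp_eq_bot, mul_left_comm,
        mul_perp_eq_bot, Quantale.bot_mul, Quantale.mul_bot, sup_bot_eq])
    hc h
  exact hd.2 ((perp_anti hcd).trans hcp)

theorem IsMPrime.purePart_le {p q : A} (hq : IsMPrime q) (h : q ≤ p) : purePart p ≤ q :=
  sSup_le fun _ hc => hq.le_of_not_perp_le fun hcq => hc.2 (hcq.trans h)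

theorem IsPF.perp_sup_perp (hPF : IsPF A) {c d : A} (hc : IsCompactElement c)
    (hd : IsCompactElement d) (h : c * d = ⊥) : perp c ⊔ perp d = ⊤ :=
  hPF c hc d hd (le_perp_iff.2 h)

theorem IsPF.eq_bot_of_mul_self (hPF : IsPF A) {c : A} (hc : IsCompactElement c)
    (h : c * c = ⊥) : c = ⊥ := by
  have h1 := hPF.perp_sup_perp hc hc h
  rw [sup_idem] at h1
  simpa [h1, ← IsIntegralQuantale.one_eq_top] using mul_perp_eq_bot c

theorem IsPF.eq_bot_of_pow (hPF : IsPF A) {c : A} (hc : IsCompactElement c) {n : ℕ}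
    (hn : 1 ≤ n) (h : c ^ n = ⊥) : c = ⊥ := by
  induction n, hn using Nat.le_induction with
  | base => rwa [pow_one] at h
  | succ n hn ih =>
    refine ih (hPF.eq_bot_of_mul_self (isCompactElement_pow hc n) ?_)
    rw [← pow_add]
    refine le_bot_iff.1 (le_trans ?_ h.le)
    -- Since `n ≥ 1`, the square of `c ^ n` is a multiple of `c ^ (n + 1) = 0`.
    rw [show n + n = n + 1 + (n - 1) by omega, pow_add]
    exact mul_le_left_of_integral _ _

/-- Choose a compact `e ≤ (cd)^⊥` with `e ≰ p`. Then `(ec)d = 0`, so `(ec)^⊥ ∨ d^⊥ = 1` by `PF`. If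
`c^⊥` and `d^⊥` were both below `p`, then `e(ec)^⊥ ≤ c^⊥ ≤ p` would put `(ec)^⊥`, and hence `1`,
below `p`. -/
theorem IsPF.isMPrime_purePart (hPF : IsPF A) {p : A} (hp : IsMPrime p) :
    IsMPrime (purePart p) := by
  refine isMPrime_of_isCompactElement ((hp.purePart_le le_rfl).trans_lt hp.1)
    fun c d hc hd h => ?_
  rw [hp.le_purePart_iff (IsCoherentQuantale.isCompactElement_mul _ _ hc hd)] at h
  rw [hp.le_purePart_iff hc, hp.le_purePart_iff hd]
  obtain ⟨e, he, hecd, hep⟩ := exists_isCompactElement_of_not_le h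
  have h1 : perp (e * c) ⊔ perp d = ⊤ :=
    hPF.perp_sup_perp (IsCoherentQuantale.isCompactElement_mul _ _ he hc) hd (by
      rw [mul_assoc, mul_comm]
      exact le_perp_iff.1 hecd)
  by_contra! H
  refine hp.1.not_ge (h1.ge.trans (sup_le ?_ H.2))
  refine (hp.2 (perp (e * c)) e (le_trans (le_perp_iff.2 ?_) H.1)).resolve_right hep
  rw [mul_left_comm, mul_comm c e, mul_comm, mul_perp_eq_bot]

end Quantale

/-! ### Minimal `m`-primes, the retraction, and compactness -/

namespace MSpec

variable {A : Type*} [CommMonoid A] [CompleteLattice A] [IsCoherentQuantale A]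

theorem isOpen_D (a : A) : IsOpen (D a) := ⟨a, rfl⟩

theorem isMin_iff_eq_purePart (hPF : IsPF A) {p : MSpec A} :
    p ∈ minimals A ↔ purePart p.val = p.val := by
  constructor
  · intro h
    have hle : purePart p.val ≤ p.val := p.isMPrime.purePart_le le_rfl
    exact le_antisymm hle
      (h (b := ⟨purePart p.val, hPF.isMPrime_purePart p.isMPrime⟩) hle)
  · intro h q hq
    change p.val ≤ q.val
    rw [← h]
    exact q.isMPrime.purePart_le hq

theorem le_iff_of_mem_minimals (hPF : IsPF A) {p : MSpec A} (hp : p ∈ minimals A) {c : A}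
    (hc : IsCompactElement c) : c ≤ p.val ↔ ¬ perp c ≤ p.val := by
  rw [← p.isMPrime.le_purePart_iff hc, (isMin_iff_eq_purePart hPF).1 hp]

/-- The unique minimal `m`-prime below `p`. -/
def toMinimals (hPF : IsPF A) (p : MSpec A) : minimals A :=
  ⟨⟨purePart p.val, hPF.isMPrime_purePart p.isMPrime⟩, fun q hq =>
    q.isMPrime.purePart_le (hq.trans (p.isMPrime.purePart_le le_rfl))⟩

theorem le_toMinimals_iff (hPF : IsPF A) {p : MSpec A} {c : A} (hc : IsCompactElement c) :
    c ≤ (toMinimals hPF p).1.val ↔ ¬ perp c ≤ p.val :=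
  p.isMPrime.le_purePart_iff hc

theorem toMinimals_le (hPF : IsPF A) (p : MSpec A) : (toMinimals hPF p).1.val ≤ p.val :=
  p.isMPrime.purePart_le le_rfl

/-- For compact `c ≤ p`, minimality provides a compact `d ≤ c^⊥` with `d ≰ p`. Then `d^⊥ ≤ p`, while
`c^⊥ ∨ d^⊥ = 1` by `PF`. -/
theorem isPure_of_mem_minimals (hPF : IsPF A) {p : MSpec A} (hp : p ∈ minimals A) :
    IsPure p.val := by
  intro c hc hcp
  rw [le_iff_of_mem_minimals hPF hp hc] at hcp
  obtain ⟨d, hd, hdc, hdp⟩ := exists_isCompactElement_of_not_le hcp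
  have h1 : perp d ≤ p.val := not_not.1 fun h => hdp
    ((le_iff_of_mem_minimals hPF hp hd).2 h)
  have h2 := hPF.perp_sup_perp hc hd (le_perp_iff.1 hdc)
  rw [sup_comm] at h2
  exact top_le_iff.1 (h2.ge.trans (sup_le_sup_right h1 _))

/-- A nonzero compact element is not nilpotent, so some `m`-prime avoids it, and so does the minimal
`m`-prime below that one. -/
theorem eq_bot_of_forall_minimals (hPF : IsPF A) {a : A}
    (h : ∀ p ∈ minimals A, a ≤ p.val) : a = ⊥ := by
  by_contra ha
  obtain ⟨c, hc, hca, hc0⟩ := exists_isCompactElement_of_not_le (mt le_bot_iff.1 ha)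
  obtain ⟨p, hp, -, hcp⟩ := exists_isMPrime (a := ⊥) hc (fun n hn => hc0 (by
    rcases Nat.eq_zero_or_pos n with rfl | hn'
    · rw [pow_zero, IsIntegralQuantale.one_eq_top] at hn
      exact le_top.trans hn
    · exact (hPF.eq_bot_of_pow hc hn' (le_bot_iff.1 hn)).le))
  exact hcp (hca.trans ((h _ (toMinimals hPF ⟨p, hp⟩).2).trans (toMinimals_le hPF _)))

theorem eq_top_of_forall_not_le {a : A} (h : ∀ p : MSpec A, ¬ a ≤ p.val) : a = ⊤ := by
  by_contra ha
  obtain ⟨p, hp, hap⟩ := exists_isMPrime_ge ha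
  exact h ⟨p, hp⟩ hap

instance : CompactSpace (MSpec A) := by
  refine ⟨isCompact_of_finite_subcover fun {ι} U hU hcover => ?_⟩
  choose a ha using hU
  obtain ⟨t, ht⟩ := CompleteLattice.IsCompactElement.exists_finset_of_le_iSup A
    (IsCoherentQuantale.isCompactElement_top (A := A)) a (by
      -- That the `D (a i)` cover the spectrum means that no `m`-prime lies above the join of the `a
      -- i`, so this join is `1`.
      rw [eq_top_of_forall_not_le (a := ⨆ i, a i) fun p hp => ?_]
      obtain ⟨i, hi⟩ := Set.mem_iUnion.1 (hcover (Set.mem_univ p))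
      rw [ha i] at hi
      exact hi ((le_iSup a i).trans hp))
  refine ⟨t, fun p _ => ?_⟩
  by_contra hp
  refine p.isMPrime.1.not_ge (ht.trans (iSup₂_le fun i hi => ?_))
  by_contra hip
  exact hp (Set.mem_biUnion hi (by rw [ha i]; exact hip))

theorem isTopologicalBasis_D :
    TopologicalSpace.IsTopologicalBasis
      (Set.range fun c : CompactElt A => (D c.val : Set (MSpec A))) := by
  refine TopologicalSpace.isTopologicalBasis_of_isOpen_of_nhds ?_ ?_
  · rintro _ ⟨c, rfl⟩
    exact isOpen_D c.val
  · rintro p _ hp ⟨a, rfl⟩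
    obtain ⟨c, hc, hca, hcp⟩ := exists_isCompactElement_of_not_le hp
    exact ⟨_, ⟨⟨c, hc⟩, rfl⟩, hcp, fun q hq h => hq (hca.trans h)⟩

/-- An `m`-prime contains exactly one of two complementary elements, so `c^⊥ ≰ p` becomes `e ≤ p`.
-/
theorem le_toMinimals_iff_of_isCompl {c e : A} (h : IsCompl (perp c) e) (hc : IsCompactElement c)
    (hPF : IsPF A) (p : MSpec A) :
    c ≤ (toMinimals hPF p).1.val ↔ e ≤ p.val := by
  rw [le_toMinimals_iff hPF hc]
  constructor
  · intro hp
    exact (p.isMPrime.2 _ _ ((mul_eq_bot_of_isCompl h).le.trans bot_le)).resolve_left hp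
  · intro he hp
    exact p.isMPrime.1.not_ge (h.sup_eq_top.ge.trans (sup_le hp he))

theorem continuous_toMinimals (hPF : IsPF A) (hPP : IsPP A) : Continuous (toMinimals hPF) := by
  refine Continuous.subtype_mk (f := fun p => (toMinimals hPF p).1)
    (isTopologicalBasis_D.continuous_iff.2 ?_) _
  rintro _ ⟨c, rfl⟩
  obtain ⟨e, he⟩ := hPP c.val c.isCompact
  exact ⟨e, Set.ext fun p => not_congr (le_toMinimals_iff_of_isCompl he c.isCompact hPF p)⟩

theorem hasContinuousRetraction_of_isPP (hPF : IsPF A) (hPP : IsPP A) :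
    HasContinuousRetraction (minimals A) :=
  ⟨toMinimals hPF, continuous_toMinimals hPF hPP, fun p =>
    Subtype.ext (MSpec.ext ((isMin_iff_eq_purePart hPF).1 p.2))⟩

theorem compactSpace_of_hasContinuousRetraction {X : Type*} [TopologicalSpace X] [CompactSpace X]
    {S : Set X} (h : HasContinuousRetraction S) : CompactSpace S := by
  obtain ⟨r, hr, hr'⟩ := h
  have hs : Function.Surjective r := fun p => ⟨p, hr' p⟩
  exact ⟨hs.range_eq ▸ isCompact_range hr⟩

theorem isPP_of_compactSpace_minimals (hPF : IsPF A) [CompactSpace (minimals A)] : IsPP A := by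
  intro c hc
  have hcl : IsCompact {p : minimals A | c ≤ p.1.val} :=
    IsClosed.isCompact ⟨(isOpen_D c).preimage continuous_subtype_val⟩
  have : Nonempty {d : A // IsCompactElement d ∧ d ≤ perp c} :=
    ⟨⟨⊥, isCompactElement_bot, bot_le⟩⟩
  -- A minimal `m`-prime above `c` does not contain `c^⊥`, so the sets `D(d)` with `d ≤ c^⊥` compact
  -- cover this closed set. They form a directed family, so a single `d` suffices.
  obtain ⟨⟨d, hd, hdc⟩, hcd⟩ := hcl.elim_directed_cover
    (fun d : {d : A // IsCompactElement d ∧ d ≤ perp c} => {p : minimals A | ¬ d.1 ≤ p.1.val})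
    (fun d => (isOpen_D d.1).preimage continuous_subtype_val)
    (fun p hp => by
      obtain ⟨d, hd, hdc, hdp⟩ := exists_isCompactElement_of_not_le
        ((le_iff_of_mem_minimals hPF p.2 hc).1 hp)
      exact Set.mem_iUnion.2 ⟨⟨d, hd, hdc⟩, hdp⟩)
    (fun d e => ⟨⟨d.1 ⊔ e.1, isCompactElement_sup d.2.1 e.2.1, sup_le d.2.2 e.2.2⟩,
      fun p hp h => hp (le_sup_left.trans h), fun p hp h => hp (le_sup_right.trans h)⟩)
  have h1 := hPF.perp_sup_perp hc hd (le_perp_iff.1 hdc)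
  refine ⟨perp d, isCompl_of_mul_eq_bot h1 (eq_bot_of_forall_minimals hPF fun p hp => ?_)⟩
  by_cases hcp : c ≤ p.val
  · have hdp : ¬ d ≤ p.val := hcd (show (⟨p, hp⟩ : minimals A) ∈ _ from hcp)
    rw [le_iff_of_mem_minimals hPF hp hd, not_not] at hdp
    exact (mul_le_right_of_integral _ _).trans hdp
  · rw [le_iff_of_mem_minimals hPF hp hc, not_not] at hcp
    exact (mul_le_left_of_integral _ _).trans hcp

end MSpec
end PPQuantale

namespace PPQuantale

variable {A : Type*} [CommMonoid A] [CompleteLattice A] [IsCoherentQuantale A]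

/-! ### Pure `m`-prime elements -/

/-- If an `m`-prime `q ≤ p` misses some compact `c ≤ p`, then `c^⊥ ≤ q ≤ p`, and purity gives `p = p
∨ c^⊥ = 1`. -/
theorem IsMPrime.isMin_of_isPure {p : A} (hp : IsMPrime p) (hpure : IsPure p) :
    (⟨p, hp⟩ : MSpec A) ∈ MSpec.minimals A := by
  intro q hq
  refine le_iff_compact_le_imp.2 fun c hc hcp => q.isMPrime.le_of_not_perp_le fun hcq => ?_
  exact hp.1.ne (top_le_iff.1 ((hpure c hc hcp).ge.trans (sup_le le_rfl (hcq.trans hq))))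

theorem Vir.val_lt_top_iff (a : Vir A) : a < ⊤ ↔ a.val < ⊤ := by
  rw [lt_top_iff_ne_top, lt_top_iff_ne_top, not_iff_not]
  constructor
  -- The top of `Vir A` is constructed as a join of pure elements; the unit `1`, shared with `A`,
  -- identifies its value.
  · rintro rfl
    exact congrArg Vir.val (IsIntegralQuantale.one_eq_top (A := Vir A)).symm |>.trans
      IsIntegralQuantale.one_eq_top
  · intro h
    refine Vir.ext (h.trans ?_)
    exact (congrArg Vir.val (IsIntegralQuantale.one_eq_top (A := Vir A)).symm |>.trans
      IsIntegralQuantale.one_eq_top).symm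

theorem IsMPrime.vir {p : A} (hp : IsMPrime p) (hpure : IsPure p) :
    IsMPrime (⟨p, hpure⟩ : Vir A) :=
  ⟨(Vir.val_lt_top_iff _).2 hp.1, fun a b h => hp.2 a.val b.val h⟩

theorem le_of_isCompl_perp {c e : A} (h : IsCompl (perp c) e) : c ≤ e :=
  le_of_sup_eq_top_of_mul_eq_bot (h.symm.sup_eq_top) (mul_perp_eq_bot c)

/-- In a `PP`-quantale the primes of the frame of pure elements are `m`-prime. -/
theorem IsPP.isMPrime_val (hPP : IsPP A) (q : MSpec (Vir A)) : IsMPrime q.val.val := by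
  refine isMPrime_of_isCompactElement ((Vir.val_lt_top_iff _).1 q.isMPrime.1)
    fun c d hc hd h => ?_
  obtain ⟨e, he⟩ := hPP c hc
  obtain ⟨f, hf⟩ := hPP d hd
  have h1 := q.val.isPure _ (IsCoherentQuantale.isCompactElement_mul _ _ hc hd) h
  have h2 : e * f ≤ q.val.val := by
    -- It suffices that `ef` kills `(cd)^⊥`: from `dc(cd)^⊥ = 0`, the element `c(cd)^⊥` is below
    -- `d^⊥` and so is killed by `f`; then `f(cd)^⊥` is below `c^⊥` and so is killed by `e`.
    refine le_of_sup_eq_top_of_mul_eq_bot h1 ?_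
    have h3 : d * (c * perp (c * d)) = ⊥ := by
      rw [← mul_assoc, mul_comm d, mul_perp_eq_bot]
    have h4 : f * (c * perp (c * d)) = ⊥ := le_bot_iff.1
      ((mul_le_mul_right (le_perp_iff.2 h3) f).trans
        (mul_eq_bot_of_isCompl hf.symm).le)
    have h5 : c * (f * perp (c * d)) = ⊥ := by rw [mul_left_comm, h4]
    rw [mul_assoc]
    exact le_bot_iff.1 ((mul_le_mul_right (le_perp_iff.2 h5) e).trans
        (mul_eq_bot_of_isCompl he.symm).le)
  exact (q.isMPrime.2 ⟨e, isPure_of_isCompl he.symm⟩ ⟨f, isPure_of_isCompl hf.symm⟩ h2).imp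
    (le_of_isCompl_perp he).trans (le_of_isCompl_perp hf).trans

/-- Under `PP` the primes of `Vir(A)` are the pure, hence the minimal, `m`-primes of `A`. The open
set is `D(e)` for the complement `e` of `c^⊥`, which is pure. -/
theorem IsPP.exists_isOpen_vir (hPP : IsPP A) (hPF : IsPF A) {c : A} (hc : IsCompactElement c) :
    ∃ U : Set (MSpec (Vir A)), IsOpen U ∧
      {a : A | ∃ q ∈ U, q.val.val = a} =
        {a : A | ∃ p ∈ MSpec.minimals A ∩ MSpec.D c, p.val = a} := by
  obtain ⟨e, he⟩ := hPP c hc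
  have key : ∀ p ∈ MSpec.minimals A, c ≤ p.val ↔ e ≤ p.val := fun p hp => by
    rw [← MSpec.le_toMinimals_iff_of_isCompl he hc hPF p, MSpec.le_toMinimals_iff hPF hc,
      MSpec.le_iff_of_mem_minimals hPF hp hc]
  refine ⟨MSpec.D ⟨e, isPure_of_isCompl he.symm⟩, ⟨_, rfl⟩, Set.ext fun a => ⟨?_, ?_⟩⟩
  · rintro ⟨q, hq, rfl⟩
    have hmin := (hPP.isMPrime_val q).isMin_of_isPure q.val.isPure
    exact ⟨_, ⟨hmin, fun h => hq ((key _ hmin).1 h)⟩, rfl⟩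
  · rintro ⟨p, ⟨hmin, hp⟩, rfl⟩
    exact ⟨⟨_, p.isMPrime.vir (MSpec.isPure_of_mem_minimals hPF hmin)⟩,
      fun h => hp ((key _ hmin).2 h), rfl⟩

theorem isPP_of_exists_isOpen_vir (hPF : IsPF A)
    (H : ∀ c : A, IsCompactElement c → ∃ U : Set (MSpec (Vir A)), IsOpen U ∧
      {a : A | ∃ q ∈ U, q.val.val = a} =
        {a : A | ∃ p ∈ MSpec.minimals A ∩ MSpec.D c, p.val = a}) : IsPP A := by
  intro c hc
  obtain ⟨_, ⟨a, rfl⟩, hU⟩ := H c hc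
  have key : ∀ p ∈ MSpec.minimals A, c ≤ p.val ↔ a.val ≤ p.val := by
    intro p hp
    refine not_iff_not.1 ⟨fun h => ?_, fun h => ?_⟩
    · obtain ⟨q, hq, hqp⟩ := hU.ge ⟨p, ⟨hp, h⟩, rfl⟩
      rw [← hqp]
      exact hq
    · obtain ⟨p', ⟨-, h'⟩, hpp'⟩ := hU.le ⟨⟨_, p.isMPrime.vir
        (MSpec.isPure_of_mem_minimals hPF hp)⟩, h, rfl⟩
      rw [← show p'.val = p.val from hpp']
      exact h'
  refine ⟨a.val, isCompl_of_mul_eq_bot (MSpec.eq_top_of_forall_not_le fun p hp => ?_)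
    (MSpec.eq_bot_of_forall_minimals hPF fun p hp => ?_)⟩
  -- Purity carries `a ≤ p` down to the minimal `m`-prime below `p`. That one then contains `c`,
  -- contradicting `c^⊥ ≤ p`.
  · have hap : a.val ≤ (MSpec.toMinimals hPF p).1.val := by
      refine le_iff_compact_le_imp.2 fun d hd hda => ?_
      rw [MSpec.le_toMinimals_iff hPF hd]
      intro hdp
      exact p.isMPrime.1.not_ge ((a.isPure d hd hda).ge.trans
        (sup_le (le_sup_right.trans hp) hdp))
    rw [← key _ (MSpec.toMinimals hPF p).2, MSpec.le_toMinimals_iff hPF hc] at hap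
    exact hap (le_sup_left.trans hp)
  · by_cases hcp : c ≤ p.val
    · exact (mul_le_right_of_integral _ _).trans ((key p hp).1 hcp)
    · rw [MSpec.le_iff_of_mem_minimals hPF hp hc, not_not] at hcp
      exact (mul_le_left_of_integral _ _).trans hcp

/-! ### The reticulation -/

theorem isStoneLattice_of_isPP (hPF : IsPF A) (hPP : IsPP A) :
    IsStoneLattice (Reticulation A) := by
  intro x
  obtain ⟨c, rfl⟩ := Reticulation.mk_surjective x
  obtain ⟨e, he⟩ := hPP c.val c.isCompact
  have hf := isCompactElement_of_isCompl he
  have he' := isCompactElement_of_isCompl he.symm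
  refine ⟨Reticulation.mk ⟨perp c.val, hf⟩, ⟨Reticulation.mk ⟨e, he'⟩,
    disjoint_iff.2 ?_, codisjoint_iff.2 ?_⟩, Set.ext fun y => ?_⟩
  · exact le_bot_iff.1 (PowLE.of_le (mul_eq_bot_of_isCompl he).le)
  · exact top_le_iff.1 (PowLE.of_le he.sup_eq_top.ge)
  · obtain ⟨d, rfl⟩ := Reticulation.mk_surjective y
    change _ = ⊥ ↔ PowLE d.val (perp c.val)
    rw [← Reticulation.mk_mul, ← le_bot_iff]
    change PowLE (c.val * d.val) ⊥ ↔ _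
    constructor
    · rintro ⟨n, hn, h⟩
      exact PowLE.of_le (le_perp_iff.2 (hPF.eq_bot_of_pow
        (IsCoherentQuantale.isCompactElement_mul _ _ c.isCompact d.isCompact) hn
        (le_bot_iff.1 h)))
    · rintro ⟨n, hn, h⟩
      refine ⟨n, hn, ?_⟩
      rw [le_perp_iff] at h
      rw [mul_pow, ← h]
      refine mul_le_mul_left ?_ _
      obtain ⟨m, rfl⟩ := Nat.exists_eq_add_of_le hn
      rw [pow_add, pow_one]
      exact mul_le_left_of_integral _ _

theorem isPP_of_isStoneLattice (hPF : IsPF A) (h : IsStoneLattice (Reticulation A)) :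
    IsPP A := by
  intro c hc
  obtain ⟨x, ⟨y, hxy⟩, hx⟩ := h (Reticulation.mk ⟨c, hc⟩)
  obtain ⟨f, rfl⟩ := Reticulation.mk_surjective x
  obtain ⟨g, rfl⟩ := Reticulation.mk_surjective y
  have eq_bot : ∀ a b : CompactElt A, Reticulation.mk a ⊓ Reticulation.mk b = ⊥ →
      a.val * b.val = ⊥ := by
    intro a b hab
    rw [← Reticulation.mk_mul, ← le_bot_iff] at hab
    obtain ⟨n, hn, hab⟩ := hab
    exact hPF.eq_bot_of_pow (IsCoherentQuantale.isCompactElement_mul _ _ a.isCompact b.isCompact)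
      hn (le_bot_iff.1 hab)
  have hfg : f.val * g.val = ⊥ := eq_bot f g hxy.inf_eq_bot
  have hsup : f.val ⊔ g.val = ⊤ := by
    have h1 := hxy.sup_eq_top.ge
    rw [← Reticulation.mk_sup] at h1
    obtain ⟨n, -, h1⟩ := h1
    refine top_le_iff.1 (le_trans ?_ h1)
    change (⊤ : A) ≤ ⊤ ^ n
    rw [← IsIntegralQuantale.one_eq_top, one_pow]
  have hperp : perp c = f.val := by
    refine le_antisymm (le_iff_compact_le_imp.2 fun d hd hdc => ?_) ?_
    · have hmem : Reticulation.mk ⟨d, hd⟩ ∈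
          {y | Reticulation.mk ⟨c, hc⟩ ⊓ y = ⊥} := by
        refine le_bot_iff.1 (PowLE.of_le ?_)
        exact (le_perp_iff.1 hdc).le
      rw [hx] at hmem
      -- `λ(d) ≤ λ(f)` bounds only a power of `d`; passing through `dg = 0` and `f ∨ g = 1` gives `d
      -- ≤ f` itself.
      refine le_of_sup_eq_top_of_mul_eq_bot hsup (eq_bot ⟨d, hd⟩ g ?_)
      exact le_bot_iff.1 ((inf_le_inf_right _ hmem).trans hxy.inf_eq_bot.le)
    · exact le_perp_iff.2 (eq_bot ⟨c, hc⟩ f (hx.ge (le_refl (Reticulation.mk f))))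
  rw [hperp]
  exact ⟨g.val, isCompl_of_mul_eq_bot hsup hfg⟩

/-- The prime ideal of the reticulation attached to an `m`-prime element. -/
def MSpec.toIdSpec (p : MSpec A) : IdSpec (Reticulation A) where
  val :=
    { carrier := {x | ∃ c : CompactElt A, Reticulation.mk c = x ∧ c.val ≤ p.val}
      lower' := by
        rintro _ x hx ⟨c, rfl, hc⟩
        obtain ⟨d, rfl⟩ := Reticulation.mk_surjective x
        obtain ⟨n, -, hn⟩ := Reticulation.mk_le_mk.1 hx
        exact ⟨d, rfl, p.isMPrime.le_of_pow_le (hn.trans hc)⟩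
      nonempty' := ⟨_, ⟨⊥, isCompactElement_bot⟩, rfl, bot_le⟩
      directed' := by
        rintro _ ⟨c, rfl, hc⟩ _ ⟨d, rfl, hd⟩
        exact ⟨_, ⟨_, Reticulation.mk_sup c d, sup_le hc hd⟩, le_sup_left, le_sup_right⟩ }
  isPrime := by
    have mem_iff : ∀ c : CompactElt A, (∃ d : CompactElt A, Reticulation.mk d =
        Reticulation.mk c ∧ d.val ≤ p.val) ↔ c.val ≤ p.val := by
      refine fun c => ⟨?_, fun h => ⟨c, rfl, h⟩⟩
      rintro ⟨d, hdc, hd⟩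
      obtain ⟨n, -, hn⟩ := Reticulation.mk_le_mk.1 hdc.ge
      exact p.isMPrime.le_of_pow_le (hn.trans hd)
    refine @Order.Ideal.IsPrime.of_mem_or_mem _ _ _ (Order.Ideal.isProper_of_notMem
      (p := (⊤ : Reticulation A)) fun h => p.isMPrime.1.not_ge
        ((mem_iff ⟨⊤, IsCoherentQuantale.isCompactElement_top⟩).1 h)) fun {x y} h => ?_
    obtain ⟨c, rfl⟩ := Reticulation.mk_surjective x
    obtain ⟨d, rfl⟩ := Reticulation.mk_surjective y
    rw [← Reticulation.mk_mul] at h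
    exact (p.isMPrime.2 _ _ ((mem_iff _).1 h)).imp (mem_iff c).2 (mem_iff d).2

/-- The choice of representative is immaterial, since an `m`-prime above a power of `c` is above
`c`. -/
theorem MSpec.mk_mem_toIdSpec {p : MSpec A} {c : CompactElt A} :
    Reticulation.mk c ∈ p.toIdSpec.val ↔ c.val ≤ p.val := by
  refine ⟨?_, fun h => ⟨c, rfl, h⟩⟩
  rintro ⟨d, hdc, hd⟩
  obtain ⟨n, -, hn⟩ := Reticulation.mk_le_mk.1 hdc.ge
  exact p.isMPrime.le_of_pow_le (hn.trans hd)

/-- The join of the compact elements whose class belongs to an ideal. -/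
def idealJoin (I : Order.Ideal (Reticulation A)) : A :=
  sSup {a | ∃ c : CompactElt A, c.val = a ∧ Reticulation.mk c ∈ I}

theorem le_idealJoin_iff {I : Order.Ideal (Reticulation A)} {c : CompactElt A} :
    c.val ≤ idealJoin I ↔ Reticulation.mk c ∈ I := by
  refine ⟨fun h => ?_, fun h => le_sSup ⟨c, rfl, h⟩⟩
  obtain ⟨_, ⟨d, rfl, hd⟩, hcd⟩ := exists_le_of_le_sSup_of_isCompactElement
    (S := {a | ∃ c : CompactElt A, c.val = a ∧ Reticulation.mk c ∈ I})
    ⟨⟨⊥, isCompactElement_bot⟩, rfl, I.bot_mem⟩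
    (by
      rintro _ ⟨a, rfl, ha⟩ _ ⟨b, rfl, hb⟩
      exact ⟨_, rfl, (Reticulation.mk_sup a b) ▸ Order.Ideal.sup_mem ha hb⟩) c.isCompact h
  exact I.lower (PowLE.of_le hcd : Reticulation.mk c ≤ Reticulation.mk d) hd

/-- The `m`-prime element attached to a prime ideal of the reticulation. -/
def IdSpec.toMSpec (P : IdSpec (Reticulation A)) : MSpec A where
  val := idealJoin P.val
  isMPrime := by
    have hP := P.isPrime
    refine isMPrime_of_isCompactElement (lt_top_iff_ne_top.2 fun h => ?_)
      fun c d hc hd h => ?_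
    · exact hP.toIsProper.top_notMem ((le_idealJoin_iff
        (c := ⟨⊤, IsCoherentQuantale.isCompactElement_top⟩)).1 h.ge)
    · have h' := (le_idealJoin_iff (c := ⟨_, IsCoherentQuantale.isCompactElement_mul _ _ hc hd⟩)).1 h
      exact (hP.mem_or_mem (x := Reticulation.mk ⟨c, hc⟩) (y := Reticulation.mk ⟨d, hd⟩) h').imp
        le_idealJoin_iff.2 le_idealJoin_iff.2

/-- The spectra of a coherent quantale and of its reticulation are homeomorphic. -/
def MSpec.homeomorphIdSpec : MSpec A ≃ₜ IdSpec (Reticulation A) where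
  toFun := MSpec.toIdSpec
  invFun := IdSpec.toMSpec
  left_inv p := MSpec.ext <| le_antisymm
    (le_iff_compact_le_imp.2 fun c hc h => MSpec.mk_mem_toIdSpec.1
      ((le_idealJoin_iff (c := ⟨c, hc⟩)).1 h))
    (le_iff_compact_le_imp.2 fun c hc h => (le_idealJoin_iff (c := ⟨c, hc⟩)).2
      (MSpec.mk_mem_toIdSpec.2 h))
  right_inv P := by
    refine IdSpec.ext (SetLike.ext fun x => ?_)
    obtain ⟨c, rfl⟩ := Reticulation.mk_surjective x
    exact MSpec.mk_mem_toIdSpec.trans le_idealJoin_iff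
  continuous_toFun := by
    refine continuous_generateFrom_iff.2 ?_
    rintro _ ⟨x, rfl⟩
    obtain ⟨c, rfl⟩ := Reticulation.mk_surjective x
    exact ⟨c.val, Set.ext fun p => not_congr MSpec.mk_mem_toIdSpec⟩
  continuous_invFun := by
    refine MSpec.isTopologicalBasis_D.continuous_iff.2 ?_
    rintro _ ⟨c, rfl⟩
    refine TopologicalSpace.isOpen_generateFrom_of_mem ⟨Reticulation.mk c, ?_⟩
    exact Set.ext fun P => not_congr le_idealJoin_iff.symm

theorem MSpec.toIdSpec_le_iff {p q : MSpec A} : p.toIdSpec ≤ q.toIdSpec ↔ p ≤ q := by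
  constructor
  · intro h
    exact le_iff_compact_le_imp.2 fun c hc hcp => MSpec.mk_mem_toIdSpec.1
      (h ((MSpec.mk_mem_toIdSpec (c := ⟨c, hc⟩)).2 hcp))
  · rintro h _ ⟨c, rfl, hc⟩
    exact MSpec.mk_mem_toIdSpec.2 (hc.trans h)

theorem MSpec.toIdSpec_mem_minimals_iff {p : MSpec A} :
    p.toIdSpec ∈ IdSpec.minimals (Reticulation A) ↔ p ∈ MSpec.minimals A :=
  OrderIso.isMin_apply
    (f := ⟨MSpec.homeomorphIdSpec.toEquiv, MSpec.toIdSpec_le_iff⟩)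

theorem HasContinuousRetraction.of_homeomorph {X Y : Type*} [TopologicalSpace X]
    [TopologicalSpace Y] (e : X ≃ₜ Y) {S : Set X} {T : Set Y} (h : ∀ x, e x ∈ T ↔ x ∈ S)
    (hS : HasContinuousRetraction S) : HasContinuousRetraction T := by
  obtain ⟨r, hr, hr'⟩ := hS
  refine ⟨fun y => ⟨e (r (e.symm y)), (h _).2 (r (e.symm y)).2⟩, ?_, fun y => Subtype.ext ?_⟩
  · exact (e.continuous.comp (continuous_subtype_val.comp (hr.comp e.symm.continuous))).subtype_mk _
  · have hy : e.symm y ∈ S := by rw [← h, e.apply_symm_apply]; exact y.2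
    have := hr' ⟨_, hy⟩
    simp only at this
    simp [this]

end PPQuantale

/-! ### The equivalences -/

theorem theorem8p7 (A : Type*) [CommMonoid A] [CompleteLattice A] [IsCoherentQuantale A]
    (hPF : IsPF A) :
    List.TFAE
      [ IsPP A,
        IsStoneLattice (Reticulation A),
        HasContinuousRetraction (IdSpec.minimals (Reticulation A)),
        HasContinuousRetraction (MSpec.minimals A),
        ∀ c : A, IsCompactElement c →
          ∃ U : Set (MSpec (Vir A)), IsOpen U ∧
            {a : A | ∃ q ∈ U, q.val.val = a} =
              {a : A | ∃ p ∈ MSpec.minimals A ∩ MSpec.D c, p.val = a},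
        CompactSpace (MSpec.minimals A) ] := by
  tfae_have 1 → 2 := isStoneLattice_of_isPP hPF
  tfae_have 2 → 1 := isPP_of_isStoneLattice hPF
  tfae_have 4 → 3 := HasContinuousRetraction.of_homeomorph MSpec.homeomorphIdSpec
    fun _ => MSpec.toIdSpec_mem_minimals_iff
  tfae_have 3 → 4 := HasContinuousRetraction.of_homeomorph MSpec.homeomorphIdSpec.symm
    fun P => by
      rw [← MSpec.toIdSpec_mem_minimals_iff]
      exact iff_of_eq (congrArg (· ∈ _) (MSpec.homeomorphIdSpec.apply_symm_apply P))
  tfae_have 1 → 4 := MSpec.hasContinuousRetraction_of_isPP hPF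
  tfae_have 4 → 6 := MSpec.compactSpace_of_hasContinuousRetraction
  tfae_have 6 → 1 := fun _ => MSpec.isPP_of_compactSpace_minimals hPF
  tfae_have 1 → 5 := fun h _ hc => h.exists_isOpen_vir hPF hc
  tfae_have 5 → 1 := isPP_of_exists_isOpen_vir hPF
  tfae_finish
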